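/- Let $d\ge 1$, let $\mathbb S^{d-1}$ be the unit sphere of $\mathbb R^d$ with surface measure $\sigma$, total area $|\mathbb S^{d-1}|=\sigma(\mathbb S^{d-1})$ and uniform distribution $\mathcal U=\sigma/|\mathbb S^{d-1}|$. Let $d_1:\mathbb R\times\mathbb R\to[0,\infty)$ be a Borel measurable pseudo-metric, i.e. symmetric with $d_1(x,z)\le C[d_1(x,y)+d_1(y,z)]$ for all $x,y,z\in\mathbb R$ and some constant $C>0$, and let $\beta\in[0,1]$. For probability measures $\rho,\tau$ on $\mathbb R$, with $\Pi(\rho,\tau)$ the set of their couplings, put $$D_{fgw}(\rho,\tau;\beta)=\min_{\pi\in\Pi(\rho,\tau)}\Big\{(1-\beta)\int d_1(x,y)\,d\pi(x,y)+\beta\iint\big[d_1(x,x')-d_1(y,y')\big]^2d\pi(x,y)\,d\pi(x',y')\Big\}\in[0,\infty],$$ where $0\cdot\infty=0$ and where $\min$ is read as $\inf$ if $d_1$ is not continuous. For $\theta\in\mathbb S^{d-1}$ let $\theta\sharp\mu$ be the image of $\mu$ under $x\mapsto\theta^\top x$. For $\kappa>0$ and $\epsilon\in\mathbb S^{d-1}$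 let $\mathrm{vMF}(\cdot|\epsilon,\kappa)$ be the von Mises–Fisher distribution, with density $C_d(\kappa)\exp(\kappa\epsilon^\top x)$ with respect to $\sigma$, where $C_d(\kappa)=\dfrac{\kappa^{d/2-1}}{(2\pi)^{d/2}I_{d/2-1}(\kappa)}$ and $I_v$ is the modified Bessel function of the first kind of order $v$. For probability measures $\mu,\nu$ on $\mathbb R^d$ define, with values in $[0,\infty]$, $$\mathrm{SFG}(\mu,\nu;\beta)=\mathbb E_{\theta\sim\mathcal U}\big[D_{fgw}(\theta\sharp\mu,\theta\sharp\nu;\beta)\big],\qquad \mathrm{SSFG}(\mu,\nu;\beta,\kappa)=\max_{\epsilon\in\mathbb S^{d-1}}\mathbb E_{\theta\sim\mathrm{vMF}(\cdot|\epsilon,\kappa)}\big[D_{fgw}(\theta\sharp\mu,\theta\sharp\nu;\beta)\big],$$ $$\text{max-SFG}(\mu,\nu;\beta)=\sup_{\theta\in\mathbb S^{d-1}}D_{fgw}(\theta\sharp\mu,\theta\sharp\nu;\beta).$$ (Where $D_{fgw}(\theta\sharp\mu,\theta\sharp\nu;\beta)$ is not measurable in $\theta$, the expectations are lower integrals.)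 The maximum over $\epsilon$ is attained; if $d_1$ is continuous, the minimum over $\pi\in\Pi(\theta\sharp\mu,\theta\sharp\nu)$ is attained for every $\theta$; if moreover $d_1$ has at most polynomial growth and $\mu,\nu$ have finite moments of all orders, then $\text{max-SFG}(\mu,\nu;\beta)$ is finite and the supremum over $\theta$ is a maximum. Furthermore: (a) $\lim_{\kappa\to0^+}\mathrm{SSFG}(\mu,\nu;\beta,\kappa)=\mathrm{SFG}(\mu,\nu;\beta)$, and, if $d_1$ is continuous, $\lim_{\kappa\to\infty}\mathrm{SSFG}(\mu,\nu;\beta,\kappa)=\text{max-SFG}(\mu,\nu;\beta)$. (b) For every $\kappa>0$, $$e^{-\kappa}C_d(\kappa)\,|\mathbb S^{d-1}|\;\mathrm{SFG}(\mu,\nu;\beta)\le\mathrm{SSFG}(\mu,\nu;\beta,\kappa)\le e^{\kappa}C_d(\kappa)\,|\mathbb S^{d-1}|\;\mathrm{SFG}(\mu,\nu;\beta)$$ and $\mathrm{SSFG}(\mu,\nu;\beta,\kappa)\le\text{max-SFG}(\mu,\nu;\beta)$. -/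

import Mathlib

open MeasureTheory Filter Topology
open scoped ENNReal RealInnerProductSpace

noncomputable section

namespace SFGW

/-- A pseudo-metric on `ℝ`: nonnegative, symmetric, and satisfying the triangle inequality up to a
universal multiplicative constant. -/
structure IsPseudoMetric (d₁ : ℝ → ℝ → ℝ) : Prop where
  nonneg : ∀ x y, 0 ≤ d₁ x y
  symm : ∀ x y, d₁ x y = d₁ y x
  weak_triangle : ∃ C : ℝ, 0 < C ∧ ∀ x y z, d₁ x z ≤ C * (d₁ x y + d₁ y z)

/-- `π` is a transport plan between `ρ` and `σ`. -/
def IsTransportPlan (ρ σ : Measure ℝ) (π : Measure (ℝ × ℝ)) : Prop :=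
  π.map Prod.fst = ρ ∧ π.map Prod.snd = σ

/-- The fused Gromov Wasserstein objective of a plan `π`, with values in `[0, ∞]`. -/
def fgwCost (d₁ : ℝ → ℝ → ℝ) (β : ℝ) (π : Measure (ℝ × ℝ)) : ℝ≥0∞ :=
  ENNReal.ofReal (1 - β) * (∫⁻ p, ENNReal.ofReal (d₁ p.1 p.2) ∂π) +
    ENNReal.ofReal β *
      (∫⁻ p, ∫⁻ q, ENNReal.ofReal ((d₁ p.1 q.1 - d₁ p.2 q.2) ^ 2) ∂π ∂π)

/-- The fused Gromov Wasserstein discrepancy between two measures on the line. -/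
def Dfgw (d₁ : ℝ → ℝ → ℝ) (β : ℝ) (ρ σ : Measure ℝ) : ℝ≥0∞ :=
  ⨅ (π : Measure (ℝ × ℝ)) (_ : IsTransportPlan ρ σ π), fgwCost d₁ β π

/-- The Euclidean space `ℝ^d`. -/
abbrev Euc (d : ℕ) : Type := EuclideanSpace ℝ (Fin d)

/-- The unit sphere of `ℝ^d`. -/
abbrev Sph (d : ℕ) : Type := Metric.sphere (0 : Euc d) 1

/-- The pushforward of a measure on `ℝ^d` through `x ↦ θᵀ x`. -/
def proj {d : ℕ} (θ : Sph d) (μ : Measure (Euc d)) : Measure ℝ :=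
  μ.map (fun x => ⟪(θ : Euc d), x⟫)

/-- The surface measure of the unit sphere. -/
def surface (d : ℕ) : Measure (Sph d) := (volume : Measure (Euc d)).toSphere

/-- The uniform distribution on the unit sphere. -/
def uniformSphere (d : ℕ) : Measure (Sph d) := (surface d Set.univ)⁻¹ • surface d

/-- The modified Bessel function of the first kind of real order `v`, at `x > 0`. -/
def besselI (v x : ℝ) : ℝ :=
  ∑' m : ℕ, (x / 2) ^ (2 * (m : ℝ) + v) / ((m.factorial : ℝ) * Real.Gamma ((m : ℝ) + v + 1))

/-- The constant `C_d(κ)` of the von Mises-Fisher density. -/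
def vMFConst (d : ℕ) (κ : ℝ) : ℝ :=
  κ ^ ((d : ℝ) / 2 - 1) / ((2 * Real.pi) ^ ((d : ℝ) / 2) * besselI ((d : ℝ) / 2 - 1) κ)

/-- The von Mises-Fisher distribution, given by its density with respect to the surface measure. -/
def vMF {d : ℕ} (ε : Sph d) (κ : ℝ) : Measure (Sph d) :=
  (surface d).withDensity
    (fun x => ENNReal.ofReal (vMFConst d κ * Real.exp (κ * ⟪(ε : Euc d), (x : Euc d)⟫)))

/-- Sliced fused Gromov Wasserstein. -/
def SFG {d : ℕ} (d₁ : ℝ → ℝ → ℝ) (β : ℝ) (μ ν : Measure (Euc d)) : ℝ≥0∞ :=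
  ∫⁻ θ, Dfgw d₁ β (proj θ μ) (proj θ ν) ∂(uniformSphere d)

/-- The expectation of the sliced discrepancy under the von Mises-Fisher law with mode `ε`. -/
def vMFMean {d : ℕ} (d₁ : ℝ → ℝ → ℝ) (β κ : ℝ) (μ ν : Measure (Euc d)) (ε : Sph d) : ℝ≥0∞ :=
  ∫⁻ θ, Dfgw d₁ β (proj θ μ) (proj θ ν) ∂(vMF ε κ)

/-- Spherical sliced fused Gromov Wasserstein. -/
def SSFG {d : ℕ} (d₁ : ℝ → ℝ → ℝ) (β κ : ℝ) (μ ν : Measure (Euc d)) : ℝ≥0∞ :=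
  ⨆ ε : Sph d, vMFMean d₁ β κ μ ν ε

/-- Max-sliced fused Gromov Wasserstein. -/
def maxSFG {d : ℕ} (d₁ : ℝ → ℝ → ℝ) (β : ℝ) (μ ν : Measure (Euc d)) : ℝ≥0∞ :=
  ⨆ θ : Sph d, Dfgw d₁ β (proj θ μ) (proj θ ν)

/-- All moments of `μ` are finite. -/
def FiniteMoments {d : ℕ} (μ : Measure (Euc d)) : Prop :=
  ∀ p : ℕ, ∫⁻ x, ENNReal.ofReal (‖x‖ ^ p) ∂μ < ∞

/-- `d₁` grows at most polynomially. -/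
def PolynomialGrowth (d₁ : ℝ → ℝ → ℝ) : Prop :=
  ∃ (K : ℝ) (p : ℕ), ∀ s t, d₁ s t ≤ K * (1 + |s| + |t|) ^ p

end SFGW

end

open MeasureTheory Filter Topology
open scoped ENNReal RealInnerProductSpace

noncomputable section

namespace SFGW

/-! Everything except the maximum over `θ` rests on three facts.

Normalisation: the vMF density integrates to 1. The exponential is expanded under the surface
integral; odd moments of `⟪ε, s⟫` vanish by symmetry, and even ones follow by computing the Gaussian
integral of `⟪ε, x⟫ ^ n` both in polar coordinates and in an orthonormal basis containing `ε`. The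
resulting series is the Bessel series.

Density bounds: the inner product of unit vectors lies in `[-1, 1]`, so the density lies between
`C_d(κ) e^{-κ}` and `C_d(κ) e^κ`. This gives (b), and since normalisation then forces `C_d(κ) |S|`
into `[e^{-κ}, e^κ]`, also the limit at 0. Moving the mode from `ε` to `ε'` changes the density by a
factor at most `e^{κ ‖ε - ε'‖}`, which makes the mean upper semicontinuous in the mode, so it
attains its maximum on the compact sphere.

Lower semicontinuity in `θ`: every plan between projections lifts to a coupling of `μ` and `ν`. The
discrepancy is thus an infimum over a weakly compact set independent of `θ`, of a jointly lower
semicontinuous cost. Optimal plans exist, and since vMF laws concentrate at their mode, the limit at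
infinity reaches the supremum. With moments and polynomial growth the cost of each fixed coupling is
continuous in `θ`, so the infimum is also upper semicontinuous and its supremum is attained. -/

theorem norm_sph {d : ℕ} (ε : Sph d) : ‖(ε : Euc d)‖ = 1 := by simp

theorem nonempty_sph {d : ℕ} (hd : 1 ≤ d) : Nonempty (Sph d) :=
  ⟨⟨EuclideanSpace.single ⟨0, hd⟩ 1, by simp⟩⟩

theorem nontrivial_euc {d : ℕ} (ε : Sph d) : Nontrivial (Euc d) :=
  ⟨⟨(ε : Euc d), 0, fun h => by simpa [h] using norm_sph ε⟩⟩

instance isFiniteMeasure_surface (d : ℕ) : IsFiniteMeasure (surface d) := by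
  unfold surface; infer_instance


/-! ### Spherical moments and the von Mises–Fisher normalising constant -/

/-- Polar decomposition of the Gaussian integral of a power of a linear form. -/
theorem integral_inner_pow_mul_exp_polar {d : ℕ} (ε : Sph d) (n : ℕ) :
    ∫ x : Euc d, ⟪(ε : Euc d), x⟫ ^ n * Real.exp (-‖x‖ ^ 2) =
      (∫ s, ⟪(ε : Euc d), (s : Euc d)⟫ ^ n ∂(surface d)) *
        ∫ r in Set.Ioi (0 : ℝ), r ^ (d - 1) * (r ^ n * Real.exp (-r ^ 2)) := by
  have := nontrivial_euc ε
  calc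
    _ = ∫ x : ({(0 : Euc d)}ᶜ : Set (Euc d)),
          ⟪(ε : Euc d), (x : Euc d)⟫ ^ n * Real.exp (-‖(x : Euc d)‖ ^ 2) ∂(volume.comap Subtype.val) := by
      rw [integral_subtype_comap (measurableSet_singleton _).compl
        fun x : Euc d => ⟪(ε : Euc d), x⟫ ^ n * Real.exp (-‖x‖ ^ 2), restrict_compl_singleton]
    _ = ∫ p, ⟪(ε : Euc d), (p.1 : Euc d)⟫ ^ n * ((p.2 : ℝ) ^ n * Real.exp (-(p.2 : ℝ) ^ 2))
          ∂((surface d).prod (.volumeIoiPow (Module.finrank ℝ (Euc d) - 1))) := by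
      rw [surface, ← (volume : Measure (Euc d)).measurePreserving_homeomorphUnitSphereProd.integral_comp
        (Homeomorph.measurableEmbedding _)]
      refine integral_congr_ae (Eventually.of_forall fun x => ?_)
      have hx : ‖(x : Euc d)‖ ≠ 0 := norm_ne_zero_iff.2 x.2
      simp only [homeomorphUnitSphereProd_apply_fst_coe, homeomorphUnitSphereProd_apply_snd_coe,
        real_inner_smul_right]
      -- The homeomorphism is `x ↦ (x / ‖x‖, ‖x‖)`; the factor `‖x‖ ^ n` restores the homogeneity of
      -- the linear form.
      rw [← mul_assoc, ← mul_pow]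
      congr 2
      field_simp
    _ = _ := by
      rw [integral_prod_mul (fun s : Sph d => ⟪(ε : Euc d), (s : Euc d)⟫ ^ n)
        (fun r : Set.Ioi (0 : ℝ) => (r : ℝ) ^ n * Real.exp (-(r : ℝ) ^ 2))]
      congr 1
      simp only [Measure.volumeIoiPow, ENNReal.ofReal]
      rw [integral_withDensity_eq_integral_smul,
        integral_subtype_comap measurableSet_Ioi fun a : ℝ =>
          Real.toNNReal (a ^ (Module.finrank ℝ (Euc d) - 1)) • (a ^ n * Real.exp (-a ^ 2))]
      · refine setIntegral_congr_fun measurableSet_Ioi fun x hx => ?_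
        simp only [NNReal.smul_def, smul_eq_mul]
        rw [Real.coe_toNNReal _ (pow_nonneg (le_of_lt hx) _), finrank_euclideanSpace,
          Fintype.card_fin]
      · exact (measurable_subtype_coe.pow_const _).real_toNNReal

theorem integral_radial_pow_mul_exp {d : ℕ} (hd : 1 ≤ d) (n : ℕ) :
    ∫ r in Set.Ioi (0 : ℝ), r ^ (d - 1) * (r ^ n * Real.exp (-r ^ 2)) =
      1 / 2 * Real.Gamma (((n : ℝ) + d) / 2) := by
  have h := integral_rpow_mul_exp_neg_rpow (p := 2) (q := (n : ℝ) + d - 1) (by norm_num)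
    (by have : (1 : ℝ) ≤ d := by exact_mod_cast hd
        have : (0 : ℝ) ≤ n := n.cast_nonneg
        linarith)
  rw [sub_add_cancel] at h
  rw [← h]
  refine setIntegral_congr_fun measurableSet_Ioi fun x hx => ?_
  have e : (n : ℝ) + d - 1 = ((n + (d - 1) : ℕ) : ℝ) := by
    push_cast [Nat.cast_sub hd]; ring
  rw [e, Real.rpow_natCast, pow_add, show (2 : ℝ) = ((2 : ℕ) : ℝ) by norm_num, Real.rpow_natCast]
  ring

theorem integral_odd_pow_mul_exp (m : ℕ) :
    ∫ t : ℝ, t ^ (2 * m + 1) * Real.exp (-t ^ 2) = 0 := by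
  have h := integral_neg_eq_self (fun t : ℝ => t ^ (2 * m + 1) * Real.exp (-t ^ 2)) volume
  have h2 : ∀ t : ℝ, (-t) ^ (2 * m + 1) * Real.exp (-(-t) ^ 2) =
      -(t ^ (2 * m + 1) * Real.exp (-t ^ 2)) := by
    intro t
    rw [Odd.neg_pow ⟨m, rfl⟩, neg_sq]; ring
  simp only [h2, integral_neg] at h
  linarith

theorem integral_even_pow_mul_exp (m : ℕ) :
    ∫ t : ℝ, t ^ (2 * m) * Real.exp (-t ^ 2) = Real.Gamma ((m : ℝ) + 1 / 2) := by
  have h := integral_comp_abs (f := fun t : ℝ => t ^ (2 * m) * Real.exp (-t ^ 2))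
  have h2 : ∀ t : ℝ, |t| ^ (2 * m) = t ^ (2 * m) := fun t => by
    rw [pow_mul, sq_abs, ← pow_mul]
  simp only [h2, sq_abs] at h
  rw [h]
  have h3 := integral_radial_pow_mul_exp (d := 1) le_rfl (2 * m)
  simp only [Nat.sub_self, pow_zero, one_mul] at h3
  rw [h3]
  push_cast
  rw [show (2 * (m : ℝ) + 1) / 2 = m + 1 / 2 by ring]
  ring

/-- A Gaussian integral of a power of a linear form reduces to one dimension. -/
theorem integral_inner_pow_mul_exp {d : ℕ} (hd : 1 ≤ d) (ε : Sph d) (n : ℕ) :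
    ∫ x : Euc d, ⟪(ε : Euc d), x⟫ ^ n * Real.exp (-‖x‖ ^ 2) =
      (∫ t : ℝ, t ^ n * Real.exp (-t ^ 2)) * √Real.pi ^ (d - 1) := by
  obtain ⟨k, rfl⟩ : ∃ k, d = k + 1 := ⟨d - 1, by omega⟩
  -- In an orthonormal basis with `b 0 = ε` the linear form is the zeroth coordinate, and the
  -- Gaussian weight factorises.
  obtain ⟨b, hb⟩ := Orthonormal.exists_orthonormalBasis_extension_of_card_eq (𝕜 := ℝ)
    (E := Euc (k + 1)) (ι := Fin (k + 1)) (by simp) (v := fun _ => (ε : Euc (k + 1))) (s := {0})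
    (by
      constructor
      · intro i; simp
      · intro i j hij
        exact absurd (Subsingleton.elim i j) hij)
  have hb0 : b 0 = (ε : Euc (k + 1)) := hb 0 rfl
  rw [← (b.measurePreserving_repr_symm).integral_comp
    b.repr.symm.toHomeomorph.measurableEmbedding]
  rw [← (PiLp.volume_preserving_toLp (Fin (k + 1))).integral_comp
    (MeasurableEquiv.toLp 2 (Fin (k + 1) → ℝ)).measurableEmbedding]
  have key : ∀ x : Fin (k + 1) → ℝ,
      ⟪(ε : Euc (k + 1)), b.repr.symm (WithLp.toLp 2 x)⟫ ^ n *
        Real.exp (-‖b.repr.symm (WithLp.toLp 2 x)‖ ^ 2) =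
      ∏ i, (if i = 0 then fun t : ℝ => t ^ n * Real.exp (-t ^ 2)
        else fun t : ℝ => Real.exp (-t ^ 2)) (x i) := by
    intro x
    rw [LinearIsometryEquiv.norm_map, ← hb0, ← OrthonormalBasis.repr_apply_apply,
      LinearIsometryEquiv.apply_symm_apply, EuclideanSpace.norm_sq_eq, ← Finset.sum_neg_distrib,
      Real.exp_sum, Fin.prod_univ_succ, Fin.prod_univ_succ]
    simp [Fin.succ_ne_zero]
    ring
  simp only [key]
  rw [integral_fintype_prod_volume_eq_prod, Fin.prod_univ_succ]
  have hg : ∫ t : ℝ, Real.exp (-t ^ 2) = √Real.pi := by simpa using integral_gaussian 1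
  simp [Fin.succ_ne_zero, hg]

theorem surface_integral_inner_pow {d : ℕ} (hd : 1 ≤ d) (ε : Sph d) (n : ℕ) :
    (∫ s, ⟪(ε : Euc d), (s : Euc d)⟫ ^ n ∂(surface d)) *
      (1 / 2 * Real.Gamma (((n : ℝ) + d) / 2)) =
      (∫ t : ℝ, t ^ n * Real.exp (-t ^ 2)) * √Real.pi ^ (d - 1) := by
  rw [← integral_radial_pow_mul_exp hd, ← integral_inner_pow_mul_exp_polar,
    integral_inner_pow_mul_exp hd]

theorem surface_integral_inner_pow_odd {d : ℕ} (hd : 1 ≤ d) (ε : Sph d) (m : ℕ) :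
    ∫ s, ⟪(ε : Euc d), (s : Euc d)⟫ ^ (2 * m + 1) ∂(surface d) = 0 := by
  have h := surface_integral_inner_pow hd ε (2 * m + 1)
  rw [integral_odd_pow_mul_exp, zero_mul] at h
  refine (mul_eq_zero.1 h).resolve_right ?_
  have : (0 : ℝ) < d := by exact_mod_cast hd
  have : 0 < Real.Gamma (((2 * m + 1 : ℕ) + d : ℝ) / 2) := Real.Gamma_pos_of_pos (by positivity)
  positivity

theorem surface_integral_inner_pow_even {d : ℕ} (hd : 1 ≤ d) (ε : Sph d) (m : ℕ) :
    ∫ s, ⟪(ε : Euc d), (s : Euc d)⟫ ^ (2 * m) ∂(surface d) =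
      2 * √Real.pi ^ d * (2 * m).factorial /
        (4 ^ m * m.factorial * Real.Gamma ((m : ℝ) + d / 2)) := by
  have h := surface_integral_inner_pow hd ε (2 * m)
  rw [integral_even_pow_mul_exp] at h
  have hd' : (0 : ℝ) < d := by exact_mod_cast hd
  have hG : 0 < Real.Gamma ((m : ℝ) + d / 2) := Real.Gamma_pos_of_pos (by positivity)
  have e : (((2 * m : ℕ) : ℝ) + d) / 2 = m + d / 2 := by push_cast; ring
  rw [e] at h
  -- Half-integer values of Gamma, by induction from `Γ(1/2) = √π`.
  have hD : Real.Gamma ((m : ℝ) + 1 / 2) * (4 ^ m * m.factorial) =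
      √Real.pi * (2 * m).factorial := by
    clear h e hG
    induction m with
    | zero => simpa using Real.Gamma_one_half_eq
    | succ m ih =>
      have : ((m + 1 : ℕ) : ℝ) + 1 / 2 = ((m : ℝ) + 1 / 2) + 1 := by push_cast; ring
      rw [this, Real.Gamma_add_one (by positivity), show 2 * (m + 1) = 2 * m + 1 + 1 by ring,
        Nat.factorial_succ, Nat.factorial_succ (2 * m + 1), Nat.factorial_succ (2 * m)]
      push_cast
      linear_combination (4 * ((m : ℝ) + 1 / 2) * (m + 1)) * ih
  have hp : √Real.pi ^ d = √Real.pi * √Real.pi ^ (d - 1) := by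
    rw [← pow_succ', Nat.sub_add_cancel hd]
  rw [eq_div_iff (by positivity), hp]
  linear_combination 2 * 4 ^ m * m.factorial * h + 2 * √Real.pi ^ (d - 1) * hD

theorem abs_inner_le_one {d : ℕ} (ε s : Sph d) : |⟪(ε : Euc d), (s : Euc d)⟫| ≤ 1 := by
  simpa using abs_real_inner_le_norm (ε : Euc d) (s : Euc d)

theorem hasSum_surface_integral_exp {d : ℕ} (ε : Sph d) (κ : ℝ) :
    HasSum (fun n : ℕ => ((n.factorial : ℝ)⁻¹ * κ ^ n) *
        ∫ s, ⟪(ε : Euc d), (s : Euc d)⟫ ^ n ∂(surface d))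
      (∫ s, Real.exp (κ * ⟪(ε : Euc d), (s : Euc d)⟫) ∂(surface d)) := by
  simp only [← integral_const_mul]
  have hsum : Summable fun n : ℕ => (n.factorial : ℝ)⁻¹ * |κ| ^ n := by
    simpa [div_eq_inv_mul] using Real.summable_pow_div_factorial |κ|
  refine hasSum_integral_of_dominated_convergence
    (fun n _ => (n.factorial : ℝ)⁻¹ * |κ| ^ n) (fun n => ?_) (fun n => ?_) ?_ ?_ ?_
  · exact Continuous.aestronglyMeasurable (by fun_prop)
  · refine Eventually.of_forall fun s => ?_
    rw [Real.norm_eq_abs, abs_mul, abs_mul, abs_pow, abs_pow, abs_inv, Nat.abs_cast]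
    exact mul_le_of_le_one_right (by positivity)
      (pow_le_one₀ (abs_nonneg _) (abs_inner_le_one ε s))
  · exact Eventually.of_forall fun s => hsum
  · exact integrable_const _
  · refine Eventually.of_forall fun s => ?_
    have h := NormedSpace.expSeries_div_hasSum_exp (𝔸 := ℝ) (κ * ⟪(ε : Euc d), (s : Euc d)⟫)
    rw [← Real.exp_eq_exp_ℝ] at h
    simpa only [mul_pow, div_eq_inv_mul, mul_assoc] using h

/-- The integral of the unnormalized von Mises-Fisher density. -/
theorem surface_integral_exp {d : ℕ} (hd : 1 ≤ d) (ε : Sph d) {κ : ℝ} (hκ : 0 < κ) :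
    ∫ s, Real.exp (κ * ⟪(ε : Euc d), (s : Euc d)⟫) ∂(surface d) =
      (2 * Real.pi) ^ ((d : ℝ) / 2) * besselI ((d : ℝ) / 2 - 1) κ / κ ^ ((d : ℝ) / 2 - 1) := by
  have h := hasSum_surface_integral_exp ε κ
  have hinj : Function.Injective fun m : ℕ => 2 * m := fun a b hab => by simpa using hab
  -- Odd moments vanish, so the series may be reindexed by even exponents.
  rw [← hinj.hasSum_iff] at h
  swap
  · intro n hn
    obtain ⟨m, rfl | rfl⟩ := Nat.even_or_odd' n
    · exact absurd ⟨m, rfl⟩ hn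
    · simp only [surface_integral_inner_pow_odd hd, mul_zero]
  rw [← h.tsum_eq, besselI, ← tsum_mul_left, ← tsum_div_const]
  refine tsum_congr fun m => ?_
  have hd' : (0 : ℝ) < d := by exact_mod_cast hd
  have hG : 0 < Real.Gamma ((m : ℝ) + d / 2) := Real.Gamma_pos_of_pos (by positivity)
  simp only [Function.comp_apply, surface_integral_inner_pow_even hd]
  rw [show (m : ℝ) + (d / 2 - 1) + 1 = m + d / 2 by ring, Real.rpow_add (by positivity),
    Real.div_rpow hκ.le zero_le_two ((d : ℝ) / 2 - 1), Real.rpow_sub_one two_ne_zero,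
    Real.mul_rpow zero_le_two Real.pi_pos.le,
    show 2 * (m : ℝ) = ((2 * m : ℕ) : ℝ) by push_cast; ring, Real.rpow_natCast]
  have hp : √Real.pi ^ d = Real.pi ^ ((d : ℝ) / 2) := by
    rw [Real.sqrt_eq_rpow, ← Real.rpow_natCast, ← Real.rpow_mul Real.pi_pos.le]
    congr 1; ring
  rw [hp, div_pow, pow_mul 2 2 m]
  have h1 : (0 : ℝ) < κ ^ ((d : ℝ) / 2 - 1) := Real.rpow_pos_of_pos hκ _
  have h2 : (0 : ℝ) < 2 ^ ((d : ℝ) / 2) := Real.rpow_pos_of_pos two_pos _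
  have h3 : ((2 * m).factorial : ℝ) ≠ 0 := by positivity
  norm_num
  field_simp

theorem surface_ne_zero {d : ℕ} (ε : Sph d) : surface d ≠ 0 := by
  have := nontrivial_euc ε
  exact Measure.toSphere_ne_zero _

theorem integrable_exp_inner {d : ℕ} (ε : Sph d) (κ : ℝ) :
    Integrable (fun s : Sph d => Real.exp (κ * ⟪(ε : Euc d), (s : Euc d)⟫)) (surface d) :=
  Continuous.integrable_of_hasCompactSupport (by fun_prop) (HasCompactSupport.of_compactSpace _)

theorem vMFConst_mul_integral {d : ℕ} (hd : 1 ≤ d) (ε : Sph d) {κ : ℝ} (hκ : 0 < κ) :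
    vMFConst d κ * ∫ s, Real.exp (κ * ⟪(ε : Euc d), (s : Euc d)⟫) ∂(surface d) = 1 := by
  have hpos : 0 < ∫ s, Real.exp (κ * ⟪(ε : Euc d), (s : Euc d)⟫) ∂(surface d) := by
    have : NeZero (surface d) := ⟨surface_ne_zero ε⟩
    exact integral_exp_pos (integrable_exp_inner ε κ)
  rw [surface_integral_exp hd ε hκ] at hpos ⊢
  have h1 : (0 : ℝ) < κ ^ ((d : ℝ) / 2 - 1) := Real.rpow_pos_of_pos hκ _
  -- Nonvanishing of the Bessel factor is read off from positivity of the integral it computes.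
  have h2 : (2 * Real.pi) ^ ((d : ℝ) / 2) * besselI ((d : ℝ) / 2 - 1) κ ≠ 0 := by
    intro h
    rw [h] at hpos
    simp at hpos
  rw [vMFConst, div_mul_div_comm, mul_comm, div_self (mul_ne_zero h2 h1.ne')]

theorem vMFConst_pos {d : ℕ} (hd : 1 ≤ d) (ε : Sph d) {κ : ℝ} (hκ : 0 < κ) :
    0 < vMFConst d κ := by
  have h := vMFConst_mul_integral hd ε hκ
  have h0 : 0 ≤ ∫ s, Real.exp (κ * ⟪(ε : Euc d), (s : Euc d)⟫) ∂(surface d) :=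
    integral_nonneg fun _ => (Real.exp_pos _).le
  by_contra hc
  push Not at hc
  nlinarith [mul_nonneg (neg_nonneg.2 hc) h0]

theorem vMF_univ {d : ℕ} (hd : 1 ≤ d) (ε : Sph d) {κ : ℝ} (hκ : 0 < κ) :
    vMF ε κ Set.univ = 1 := by
  rw [vMF, withDensity_apply _ MeasurableSet.univ, setLIntegral_univ,
    ← ofReal_integral_eq_lintegral_ofReal ((integrable_exp_inner ε κ).const_mul _),
    integral_const_mul, vMFConst_mul_integral hd ε hκ, ENNReal.ofReal_one]
  exact Eventually.of_forall fun s => mul_nonneg (vMFConst_pos hd ε hκ).le (Real.exp_pos _).le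

/-! ### Weak lower semicontinuity and compactness of couplings -/

/-- Integration of a nonnegative continuous function is lower semicontinuous for weak
convergence. -/
theorem lowerSemicontinuous_lintegral {X : Type*} [TopologicalSpace X] [MeasurableSpace X]
    [OpensMeasurableSpace X] {h : X → ℝ} (hc : Continuous h) :
    LowerSemicontinuous fun π : ProbabilityMeasure X =>
      ∫⁻ x, ENNReal.ofReal (h x) ∂(π : Measure X) := by
  -- The truncations `min h n` increase to the positive part of `h`, and each has a weakly
  -- continuous integral; a supremum of continuous functions is lower semicontinuous.
  let g : ℕ → BoundedContinuousFunction X NNReal := fun n =>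
    BoundedContinuousFunction.mkOfBound ⟨fun x => min (h x).toNNReal n, by fun_prop⟩ n
      (fun x y => by
        rw [NNReal.dist_eq]
        have h1 : ((min (h x).toNNReal n : NNReal) : ℝ) ≤ n := by
          exact_mod_cast min_le_right _ _
        have h2 : ((min (h y).toNNReal n : NNReal) : ℝ) ≤ n := by
          exact_mod_cast min_le_right _ _
        have h3 := (min (h x).toNNReal (n : NNReal)).coe_nonneg
        have h4 := (min (h y).toNNReal (n : NNReal)).coe_nonneg
        simp only [ContinuousMap.coe_mk]
        rw [abs_le]
        constructor <;> linarith)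
  have hg : ∀ n x, g n x = min (h x).toNNReal n := fun _ _ => rfl
  have heq : (fun π : ProbabilityMeasure X => ∫⁻ x, ENNReal.ofReal (h x) ∂(π : Measure X)) =
      fun π : ProbabilityMeasure X => ⨆ n, ∫⁻ x, (g n x : ℝ≥0∞) ∂(π : Measure X) := by
    funext π
    rw [← lintegral_iSup]
    · refine lintegral_congr fun x => ?_
      simp only [hg]
      refine le_antisymm ?_ (iSup_le fun n => ENNReal.coe_le_coe.2 (min_le_left _ _))
      obtain ⟨n, hn⟩ := exists_nat_ge (h x).toNNReal
      refine le_iSup_of_le n ?_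
      rw [min_eq_left hn]
      rfl
    · intro n
      exact ((g n).continuous.measurable).coe_nnreal_ennreal
    · intro n m hnm x
      simp only [hg]
      exact ENNReal.coe_le_coe.2 (min_le_min_left _ (by exact_mod_cast hnm))
  rw [heq]
  exact lowerSemicontinuous_iSup fun n =>
    (ProbabilityMeasure.continuous_lintegral_boundedContinuousFunction (g n)).lowerSemicontinuous

theorem lowerSemicontinuous_const_mul {X : Type*} [TopologicalSpace X] {f : X → ℝ≥0∞}
    (hf : LowerSemicontinuous f) {a : ℝ≥0∞} (ha : a ≠ ∞) :
    LowerSemicontinuous fun x => a * f x :=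
  (ENNReal.continuous_const_mul ha).comp_lowerSemicontinuous hf (fun _ _ h => mul_le_mul' le_rfl h)

theorem lowerSemicontinuous_fgwCost {d₁ : ℝ → ℝ → ℝ} (hc : Continuous (Function.uncurry d₁))
    (β : ℝ) :
    LowerSemicontinuous fun π : ProbabilityMeasure (ℝ × ℝ) => fgwCost d₁ β (π : Measure (ℝ × ℝ)) := by
  have hq : Continuous fun z : (ℝ × ℝ) × (ℝ × ℝ) =>
      (d₁ z.1.1 z.2.1 - d₁ z.1.2 z.2.2) ^ 2 := by
    have h1 : Continuous fun z : (ℝ × ℝ) × (ℝ × ℝ) => d₁ z.1.1 z.2.1 :=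
      hc.comp (g := Function.uncurry d₁) (f := fun z : (ℝ × ℝ) × (ℝ × ℝ) => (z.1.1, z.2.1))
        (by fun_prop)
    have h2 : Continuous fun z : (ℝ × ℝ) × (ℝ × ℝ) => d₁ z.1.2 z.2.2 :=
      hc.comp (g := Function.uncurry d₁) (f := fun z : (ℝ × ℝ) × (ℝ × ℝ) => (z.1.2, z.2.2))
        (by fun_prop)
    fun_prop
  -- The quadratic term is linear in `π ⊗ π`, which depends continuously on `π`.
  have hprod : Continuous fun π : ProbabilityMeasure (ℝ × ℝ) => π.prod π :=
    ProbabilityMeasure.continuous_prod.comp (continuous_id.prodMk continuous_id)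
  have h2 := (lowerSemicontinuous_lintegral hq).comp hprod
  have h1 := lowerSemicontinuous_lintegral (X := ℝ × ℝ) (h := fun p => d₁ p.1 p.2) hc
  refine LowerSemicontinuous.add
    (lowerSemicontinuous_const_mul h1 ENNReal.ofReal_ne_top)
    (lowerSemicontinuous_const_mul ?_ ENNReal.ofReal_ne_top)
  convert h2 using 1
  funext π
  simp only [Function.comp_apply, ProbabilityMeasure.toMeasure_prod]
  rw [lintegral_prod _ (by
    exact (ENNReal.measurable_ofReal.comp hq.measurable).aemeasurable)]

/-- Weakly compact set of couplings of two probability measures. -/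
theorem isCompact_couplings {X Y : Type*} [MeasurableSpace X] [TopologicalSpace X] [PolishSpace X]
    [BorelSpace X] [MeasurableSpace Y] [TopologicalSpace Y] [PolishSpace Y] [BorelSpace Y]
    (μ : Measure X) (ν : Measure Y) [IsProbabilityMeasure μ] [IsProbabilityMeasure ν] :
    IsCompact {Γ : ProbabilityMeasure (X × Y) |
      (Γ : Measure (X × Y)).map Prod.fst = μ ∧ (Γ : Measure (X × Y)).map Prod.snd = ν} := by
  set S := {Γ : ProbabilityMeasure (X × Y) |
      (Γ : Measure (X × Y)).map Prod.fst = μ ∧ (Γ : Measure (X × Y)).map Prod.snd = ν}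
  have hclosed : IsClosed S := by
    let μ' : ProbabilityMeasure X := ⟨μ, inferInstance⟩
    let ν' : ProbabilityMeasure Y := ⟨ν, inferInstance⟩
    have : S = {Γ | Γ.map measurable_fst.aemeasurable = μ'} ∩
        {Γ | Γ.map measurable_snd.aemeasurable = ν'} := by
      ext Γ
      exact ⟨fun h => ⟨Subtype.ext h.1, Subtype.ext h.2⟩,
        fun h => ⟨congrArg Subtype.val h.1, congrArg Subtype.val h.2⟩⟩
    rw [this]
    exact (isClosed_eq (ProbabilityMeasure.continuous_map continuous_fst) continuous_const).inter
      (isClosed_eq (ProbabilityMeasure.continuous_map continuous_snd) continuous_const)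
  rw [← hclosed.closure_eq]
  refine isCompact_closure_of_isTightMeasureSet (IsTightMeasureSet.prodMk ?_ ?_)
  · refine (isTightMeasureSet_singleton (μ := μ)).subset ?_
    rintro _ ⟨_, ⟨Γ, hΓ, rfl⟩, rfl⟩
    exact hΓ.1
  · refine (isTightMeasureSet_singleton (μ := ν)).subset ?_
    rintro _ ⟨_, ⟨Γ, hΓ, rfl⟩, rfl⟩
    exact hΓ.2

/-- The infimum over a compact set of a jointly lower semicontinuous function is lower
semicontinuous. -/
theorem lowerSemicontinuous_biInf_of_isCompact {X Y α : Type*} [TopologicalSpace X]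
    [TopologicalSpace Y] [CompleteLinearOrder α] [DenselyOrdered α] {F : X → Y → α}
    (hF : LowerSemicontinuous fun p : X × Y => F p.1 p.2) {K : Set Y} (hK : IsCompact K) :
    LowerSemicontinuous fun x => ⨅ y ∈ K, F x y := by
  intro x₀ c hc
  -- Strict bounds become weak after taking the infimum over `K`; the gap between `c` and `c'`
  -- absorbs this.
  obtain ⟨c', hcc', hc'⟩ := exists_between hc
  obtain ⟨u, v, hu, hv, hxu, hKv, huv⟩ := generalized_tube_lemma (s := {x₀}) isCompact_singleton hK
    (hF.isOpen_preimage c') (by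
      rintro ⟨x, y⟩ ⟨hx, hy⟩
      obtain rfl : x = x₀ := hx
      exact lt_of_lt_of_le hc' (biInf_le (fun y => F x y) hy))
  filter_upwards [hu.mem_nhds (hxu rfl)] with x hx
  exact lt_of_lt_of_le hcc' (le_iInf₂ fun y hy => (huv (Set.mk_mem_prod hx (hKv hy)) : c' < _).le)

/-! ### Lifting plans between projections to couplings on `ℝ^d` -/

/-- The law of the pair of projections of a coupling. -/
def projPair {d : ℕ} (θ : Sph d) (Γ : Measure (Euc d × Euc d)) : Measure (ℝ × ℝ) :=
  Γ.map fun z => (⟪(θ : Euc d), z.1⟫, ⟪(θ : Euc d), z.2⟫)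

theorem isTransportPlan_projPair {d : ℕ} (θ : Sph d) {μ ν : Measure (Euc d)}
    {Γ : Measure (Euc d × Euc d)} (hμ : Γ.map Prod.fst = μ) (hν : Γ.map Prod.snd = ν) :
    IsTransportPlan (proj θ μ) (proj θ ν) (projPair θ Γ) := by
  subst hμ hν
  constructor <;>
  · simp only [projPair, proj]
    rw [Measure.map_map (by fun_prop) (by fun_prop), Measure.map_map (by fun_prop) (by fun_prop)]
    rfl

/-- The projected law is the image of `δ_θ ⊗ Γ` under a fixed continuous map, hence weakly
continuous jointly in `(θ, Γ)`. -/
theorem lowerSemicontinuous_fgwCost_projPair {d : ℕ} {d₁ : ℝ → ℝ → ℝ}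
    (hc : Continuous (Function.uncurry d₁)) (β : ℝ) :
    LowerSemicontinuous fun p : Sph d × ProbabilityMeasure (Euc d × Euc d) =>
      fgwCost d₁ β (projPair p.1 (p.2 : Measure (Euc d × Euc d))) := by
  have hg : Continuous fun w : Sph d × (Euc d × Euc d) =>
      (⟪(w.1 : Euc d), w.2.1⟫, ⟪(w.1 : Euc d), w.2.2⟫) := by fun_prop
  have hcont : Continuous fun p : Sph d × ProbabilityMeasure (Euc d × Euc d) =>
      ((diracProba p.1).prod p.2).map hg.measurable.aemeasurable :=
    (ProbabilityMeasure.continuous_map hg).comp (ProbabilityMeasure.continuous_prod.comp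
      ((continuous_diracProba.comp continuous_fst).prodMk continuous_snd))
  convert (lowerSemicontinuous_fgwCost hc β).comp hcont using 1
  funext p
  simp only [Function.comp_apply, ProbabilityMeasure.toMeasure_map,
    ProbabilityMeasure.toMeasure_prod, projPair]
  congr 1
  change _ = Measure.map _ ((Measure.dirac p.1).prod _)
  rw [Measure.dirac_prod, Measure.map_map hg.measurable (by fun_prop)]
  rfl

open ProbabilityTheory in
/-- A measure on a product whose first marginal is a pushforward `μ.map p` lifts along `p`. -/
theorem exists_lift_fst {X S Z : Type*} [MeasurableSpace X] [MeasurableSpace S]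
    [MeasurableSpace Z] [StandardBorelSpace Z] [Nonempty Z] {p : X → S} (hp : Measurable p)
    (μ : Measure X) [IsProbabilityMeasure μ] (π : Measure (S × Z))
    (hπ : π.map Prod.fst = μ.map p) :
    ∃ Γ : Measure (X × Z), Γ.map Prod.fst = μ ∧ Γ.map (Prod.map p id) = π := by
  have : IsProbabilityMeasure (π.map Prod.fst) := by
    rw [hπ]; exact Measure.isProbabilityMeasure_map hp.aemeasurable
  have : IsProbabilityMeasure π := Measure.isProbabilityMeasure_of_map Prod.fst
  -- Draw `x` from `μ`, then the second coordinate from the conditional law of `π` given `p x`.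
  refine ⟨μ ⊗ₘ (π.condKernel.comap p hp), Measure.fst_compProd _ _, ?_⟩
  conv_rhs => rw [← π.disintegrate π.condKernel]
  ext s hs
  rw [Measure.map_apply (by fun_prop) hs, Measure.compProd_apply (by measurability),
    Measure.compProd_apply hs, Measure.fst, hπ, lintegral_map ?_ hp]
  · rfl
  · exact Kernel.measurable_kernel_prodMk_left hs

/-- Every plan between two projections comes from a coupling of the original measures. -/
theorem exists_coupling_projPair {d : ℕ} (θ : Sph d) (μ ν : Measure (Euc d))
    [IsProbabilityMeasure μ] [IsProbabilityMeasure ν] {π : Measure (ℝ × ℝ)}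
    (hπ : IsTransportPlan (proj θ μ) (proj θ ν) π) :
    ∃ Γ : ProbabilityMeasure (Euc d × Euc d),
      ((Γ : Measure (Euc d × Euc d)).map Prod.fst = μ ∧
        (Γ : Measure (Euc d × Euc d)).map Prod.snd = ν) ∧
      projPair θ (Γ : Measure (Euc d × Euc d)) = π := by
  have hp : Measurable fun x : Euc d => ⟪(θ : Euc d), x⟫ := by fun_prop
  obtain ⟨Γ₁, h₁, h₁'⟩ := exists_lift_fst hp μ π hπ.1
  -- The first coordinate is already lifted; swapping lets the same lemma lift the second.
  obtain ⟨Γ₂, h₂, h₂'⟩ := exists_lift_fst hp ν (Γ₁.map Prod.swap) (by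
    rw [Measure.map_map measurable_fst measurable_swap]
    have h := hπ.2
    rw [← h₁', Measure.map_map measurable_snd (by fun_prop)] at h
    exact h)
  have hfst : (Γ₂.map Prod.swap).map Prod.fst = μ := by
    have h := congrArg (Measure.map Prod.snd) h₂'
    rw [Measure.map_map measurable_snd (by fun_prop),
      Measure.map_map measurable_snd measurable_swap] at h
    rw [Measure.map_map measurable_fst measurable_swap, ← h₁]
    exact h
  have : IsProbabilityMeasure ((Γ₂.map Prod.swap).map Prod.fst) := by rwa [hfst]
  have : IsProbabilityMeasure (Γ₂.map Prod.swap) := Measure.isProbabilityMeasure_of_map Prod.fst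
  refine ⟨⟨Γ₂.map Prod.swap, this⟩, ⟨hfst, ?_⟩, ?_⟩
  · change (Γ₂.map Prod.swap).map Prod.snd = ν
    rw [Measure.map_map measurable_snd measurable_swap, ← h₂]
    rfl
  · change (Γ₂.map Prod.swap).map _ = π
    have h := congrArg (Measure.map (Prod.map (fun x : Euc d => ⟪(θ : Euc d), x⟫) id))
      (congrArg (Measure.map Prod.swap) h₂')
    rw [Measure.map_map measurable_swap measurable_swap, Prod.swap_swap_eq, Measure.map_id,
      h₁', Measure.map_map measurable_swap (by fun_prop),
      Measure.map_map (by fun_prop) (by fun_prop)] at h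
    rw [← h, Measure.map_map (by fun_prop) measurable_swap]
    rfl

/-- The set of couplings of two measures on `ℝ^d`. -/
def couplings {d : ℕ} (μ ν : Measure (Euc d)) : Set (ProbabilityMeasure (Euc d × Euc d)) :=
  {Γ | (Γ : Measure (Euc d × Euc d)).map Prod.fst = μ ∧
    (Γ : Measure (Euc d × Euc d)).map Prod.snd = ν}

theorem couplings_nonempty {d : ℕ} (μ ν : Measure (Euc d)) [IsProbabilityMeasure μ]
    [IsProbabilityMeasure ν] : (couplings μ ν).Nonempty :=
  ⟨⟨μ.prod ν, inferInstance⟩, by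
    constructor
    · change (μ.prod ν).map Prod.fst = μ
      simp
    · change (μ.prod ν).map Prod.snd = ν
      simp⟩

/-- The discrepancy of two projections is an infimum over the couplings upstairs. -/
theorem Dfgw_proj_eq_biInf {d : ℕ} (d₁ : ℝ → ℝ → ℝ) (β : ℝ) (θ : Sph d) (μ ν : Measure (Euc d))
    [IsProbabilityMeasure μ] [IsProbabilityMeasure ν] :
    Dfgw d₁ β (proj θ μ) (proj θ ν) =
      ⨅ Γ ∈ couplings μ ν, fgwCost d₁ β (projPair θ (Γ : Measure (Euc d × Euc d))) := by
  refine le_antisymm (le_iInf₂ fun Γ hΓ => ?_) (le_iInf₂ fun π hπ => ?_)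
  · exact iInf₂_le _ (isTransportPlan_projPair θ hΓ.1 hΓ.2)
  · obtain ⟨Γ, hΓ, rfl⟩ := exists_coupling_projPair θ μ ν hπ
    exact iInf₂_le Γ hΓ

theorem lowerSemicontinuous_Dfgw_proj {d : ℕ} {d₁ : ℝ → ℝ → ℝ}
    (hc : Continuous (Function.uncurry d₁)) (β : ℝ) (μ ν : Measure (Euc d))
    [IsProbabilityMeasure μ] [IsProbabilityMeasure ν] :
    LowerSemicontinuous fun θ : Sph d => Dfgw d₁ β (proj θ μ) (proj θ ν) := by
  simp only [Dfgw_proj_eq_biInf]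
  exact lowerSemicontinuous_biInf_of_isCompact (lowerSemicontinuous_fgwCost_projPair hc β)
    (isCompact_couplings μ ν)

theorem exists_optimal_plan {d : ℕ} {d₁ : ℝ → ℝ → ℝ}
    (hc : Continuous (Function.uncurry d₁)) (β : ℝ) (μ ν : Measure (Euc d))
    [IsProbabilityMeasure μ] [IsProbabilityMeasure ν] (θ : Sph d) :
    ∃ π : Measure (ℝ × ℝ), IsTransportPlan (proj θ μ) (proj θ ν) π ∧
      fgwCost d₁ β π = Dfgw d₁ β (proj θ μ) (proj θ ν) := by
  have hlsc : LowerSemicontinuous fun Γ : ProbabilityMeasure (Euc d × Euc d) =>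
      fgwCost d₁ β (projPair θ (Γ : Measure (Euc d × Euc d))) :=
    (lowerSemicontinuous_fgwCost_projPair hc β).comp
      (g := fun Γ => (θ, Γ)) (by fun_prop)
  obtain ⟨Γ, hΓ, hmin⟩ := (hlsc.lowerSemicontinuousOn _).exists_isMinOn
    (couplings_nonempty μ ν) (isCompact_couplings μ ν)
  refine ⟨_, isTransportPlan_projPair θ hΓ.1 hΓ.2, ?_⟩
  rw [Dfgw_proj_eq_biInf]
  exact le_antisymm (le_iInf₂ fun Γ' hΓ' => hmin hΓ') (iInf₂_le Γ hΓ)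

/-! ### Finiteness and attainment of the max-sliced discrepancy -/

theorem lintegral_weight_pow_lt_top {d : ℕ} {μ ν : Measure (Euc d)} [IsProbabilityMeasure μ]
    (hμ : FiniteMoments μ) (hν : FiniteMoments ν) {Γ : ProbabilityMeasure (Euc d × Euc d)}
    (hΓ : Γ ∈ couplings μ ν) (q : ℕ) :
    ∫⁻ z, ENNReal.ofReal ((1 + ‖z.1‖ + ‖z.2‖) ^ q) ∂(Γ : Measure (Euc d × Euc d)) < ∞ := by
  have hle : ∀ z : Euc d × Euc d, ENNReal.ofReal ((1 + ‖z.1‖ + ‖z.2‖) ^ q) ≤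
      ENNReal.ofReal (3 ^ q) *
        (1 + (ENNReal.ofReal (‖z.1‖ ^ q) + ENNReal.ofReal (‖z.2‖ ^ q))) := by
    intro z
    have h1 := norm_nonneg z.1
    have h2 := norm_nonneg z.2
    rw [← ENNReal.ofReal_one, ← ENNReal.ofReal_add (by positivity) (by positivity),
      ← ENNReal.ofReal_add zero_le_one (by positivity), ← ENNReal.ofReal_mul (by positivity)]
    refine ENNReal.ofReal_le_ofReal ?_
    have hp1 : 0 ≤ ‖z.1‖ ^ q := by positivity
    have hp2 : 0 ≤ ‖z.2‖ ^ q := by positivity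
    have hm : (1 + ‖z.1‖ + ‖z.2‖) ≤ 3 * max 1 (max ‖z.1‖ ‖z.2‖) := by
      have := le_max_left 1 (max ‖z.1‖ ‖z.2‖)
      have := (le_max_left ‖z.1‖ ‖z.2‖).trans (le_max_right 1 (max ‖z.1‖ ‖z.2‖))
      have := (le_max_right ‖z.1‖ ‖z.2‖).trans (le_max_right 1 (max ‖z.1‖ ‖z.2‖))
      linarith
    refine (pow_le_pow_left₀ (by positivity) hm q).trans ?_
    rw [mul_pow]
    refine mul_le_mul_of_nonneg_left ?_ (by positivity)
    rcases max_choice 1 (max ‖z.1‖ ‖z.2‖) with h | h <;> rw [h]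
    · rw [one_pow]; linarith
    · rcases max_choice ‖z.1‖ ‖z.2‖ with h' | h' <;> rw [h'] <;> linarith
  refine (lintegral_mono hle).trans_lt ?_
  rw [lintegral_const_mul _ (by fun_prop), lintegral_add_left (by fun_prop),
    lintegral_add_left (by fun_prop)]
  have hfst : ∫⁻ z, ENNReal.ofReal (‖z.1‖ ^ q) ∂(Γ : Measure (Euc d × Euc d)) < ∞ := by
    have h := hμ q
    rw [← hΓ.1, lintegral_map (by fun_prop) measurable_fst] at h
    exact h
  have hsnd : ∫⁻ z, ENNReal.ofReal (‖z.2‖ ^ q) ∂(Γ : Measure (Euc d × Euc d)) < ∞ := by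
    have h := hν q
    rw [← hΓ.2, lintegral_map (by fun_prop) measurable_snd] at h
    exact h
  refine ENNReal.mul_lt_top ENNReal.ofReal_lt_top (ENNReal.add_lt_top.2 ⟨?_,
    ENNReal.add_lt_top.2 ⟨hfst, hsnd⟩⟩)
  simp

/-- The objective of a projected coupling as integrals over the coupling. -/
theorem fgwCost_projPair {d : ℕ} {d₁ : ℝ → ℝ → ℝ} (hm : Measurable (Function.uncurry d₁)) (β : ℝ)
    (θ : Sph d) (Γ : Measure (Euc d × Euc d)) [IsProbabilityMeasure Γ] :
    fgwCost d₁ β (projPair θ Γ) =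
      ENNReal.ofReal (1 - β) *
        (∫⁻ z, ENNReal.ofReal (d₁ ⟪(θ : Euc d), z.1⟫ ⟪(θ : Euc d), z.2⟫) ∂Γ) +
      ENNReal.ofReal β *
        (∫⁻ w, ENNReal.ofReal ((d₁ ⟪(θ : Euc d), w.1.1⟫ ⟪(θ : Euc d), w.2.1⟫ -
          d₁ ⟪(θ : Euc d), w.1.2⟫ ⟪(θ : Euc d), w.2.2⟫) ^ 2) ∂(Γ.prod Γ)) := by
  have hP : Measurable fun z : Euc d × Euc d => (⟪(θ : Euc d), z.1⟫, ⟪(θ : Euc d), z.2⟫) := by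
    fun_prop
  have : IsProbabilityMeasure (projPair θ Γ) := Measure.isProbabilityMeasure_map hP.aemeasurable
  have hq : Measurable fun z : (ℝ × ℝ) × (ℝ × ℝ) =>
      ENNReal.ofReal ((d₁ z.1.1 z.2.1 - d₁ z.1.2 z.2.2) ^ 2) := by
    have h1 : Measurable fun z : (ℝ × ℝ) × (ℝ × ℝ) => d₁ z.1.1 z.2.1 :=
      hm.comp (f := fun z : (ℝ × ℝ) × (ℝ × ℝ) => (z.1.1, z.2.1)) (by fun_prop)
    have h2 : Measurable fun z : (ℝ × ℝ) × (ℝ × ℝ) => d₁ z.1.2 z.2.2 :=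
      hm.comp (f := fun z : (ℝ × ℝ) × (ℝ × ℝ) => (z.1.2, z.2.2)) (by fun_prop)
    fun_prop
  have h1 : Measurable fun p : ℝ × ℝ => ENNReal.ofReal (d₁ p.1 p.2) := hm.ennreal_ofReal
  rw [fgwCost, lintegral_lintegral (f := fun p q : ℝ × ℝ =>
    ENNReal.ofReal ((d₁ p.1 q.1 - d₁ p.2 q.2) ^ 2)) hq.aemeasurable]
  simp only [projPair]
  rw [Measure.map_prod_map _ _ hP hP, lintegral_map hq (by fun_prop), lintegral_map h1 hP]
  rfl

theorem abs_inner_sph_le {d : ℕ} (θ : Sph d) (x : Euc d) : |⟪(θ : Euc d), x⟫| ≤ ‖x‖ := by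
  simpa using abs_real_inner_le_norm (θ : Euc d) x

/-- Dominated convergence: since `|⟪θ, x⟫| ≤ ‖x‖`, polynomial growth gives integrable bounds
independent of `θ`. -/
theorem continuous_and_fgwCost_lt_top {d : ℕ} {d₁ : ℝ → ℝ → ℝ} (hd₁ : IsPseudoMetric d₁)
    (hc : Continuous (Function.uncurry d₁)) (hgrowth : PolynomialGrowth d₁) (β : ℝ)
    {μ ν : Measure (Euc d)} [IsProbabilityMeasure μ]
    (hμ : FiniteMoments μ) (hν : FiniteMoments ν) {Γ : ProbabilityMeasure (Euc d × Euc d)}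
    (hΓ : Γ ∈ couplings μ ν) :
    (Continuous fun θ : Sph d => fgwCost d₁ β (projPair θ (Γ : Measure (Euc d × Euc d)))) ∧
      ∀ θ : Sph d, fgwCost d₁ β (projPair θ (Γ : Measure (Euc d × Euc d))) < ∞ := by
  obtain ⟨K, p, hK⟩ := hgrowth
  have hbound : ∀ (θ : Sph d) (x y : Euc d) (r : ℝ), 1 + ‖x‖ + ‖y‖ ≤ r →
      d₁ ⟪(θ : Euc d), x⟫ ⟪(θ : Euc d), y⟫ ≤ |K| * r ^ p := by
    intro θ x y r hr
    refine (hK _ _).trans (mul_le_mul (le_abs_self K) ?_ (by positivity) (abs_nonneg K))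
    refine pow_le_pow_left₀ (by positivity) (le_trans ?_ hr) p
    linarith [abs_inner_sph_le θ x, abs_inner_sph_le θ y]
  have hcomp : ∀ {Z : Type} [TopologicalSpace Z] (a b : Z → ℝ), Continuous a → Continuous b →
      Continuous fun z => d₁ (a z) (b z) := fun a b ha hb => hc.comp (ha.prodMk hb)
  let w : Euc d × Euc d → ℝ := fun z => 1 + ‖z.1‖ + ‖z.2‖
  have hw1 : ∀ z, 1 ≤ w z := fun z => by
    have h1 := norm_nonneg z.1
    have h2 := norm_nonneg z.2
    simp only [w]; linarith
  have hwc : Continuous w := by fun_prop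
  let B₁ : Euc d × Euc d → ℝ≥0∞ := fun z => ENNReal.ofReal |K| * ENNReal.ofReal (w z ^ p)
  let B₂ : (Euc d × Euc d) × (Euc d × Euc d) → ℝ≥0∞ := fun z =>
    ENNReal.ofReal (|K| ^ 2) * (ENNReal.ofReal (w z.1 ^ (2 * p)) * ENNReal.ofReal (w z.2 ^ (2 * p)))
  have hB₁ : ∫⁻ z, B₁ z ∂(Γ : Measure (Euc d × Euc d)) ≠ ∞ := by
    rw [lintegral_const_mul _ (by fun_prop)]
    exact (ENNReal.mul_lt_top ENNReal.ofReal_lt_top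
      (lintegral_weight_pow_lt_top hμ hν hΓ p)).ne
  have hB₂ : ∫⁻ z, B₂ z ∂((Γ : Measure (Euc d × Euc d)).prod (Γ : Measure (Euc d × Euc d))) ≠ ∞ := by
    rw [lintegral_const_mul _ (by fun_prop),
      lintegral_prod_mul (f := fun z => ENNReal.ofReal (w z ^ (2 * p)))
        (g := fun z => ENNReal.ofReal (w z ^ (2 * p)))
        (by fun_prop) (by fun_prop)]
    have := lintegral_weight_pow_lt_top hμ hν hΓ (2 * p)
    exact (ENNReal.mul_lt_top ENNReal.ofReal_lt_top (ENNReal.mul_lt_top this this)).ne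
  have hle₁ : ∀ (θ : Sph d) (z : Euc d × Euc d),
      ENNReal.ofReal (d₁ ⟪(θ : Euc d), z.1⟫ ⟪(θ : Euc d), z.2⟫) ≤ B₁ z := by
    intro θ z
    simp only [B₁]
    rw [← ENNReal.ofReal_mul (abs_nonneg K)]
    exact ENNReal.ofReal_le_ofReal (hbound θ _ _ _ le_rfl)
  have hle₂ : ∀ (θ : Sph d) (z : (Euc d × Euc d) × (Euc d × Euc d)),
      ENNReal.ofReal ((d₁ ⟪(θ : Euc d), z.1.1⟫ ⟪(θ : Euc d), z.2.1⟫ -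
          d₁ ⟪(θ : Euc d), z.1.2⟫ ⟪(θ : Euc d), z.2.2⟫) ^ 2) ≤ B₂ z := by
    intro θ z
    have hz1 := hw1 z.1
    have hz2 := hw1 z.2
    simp only [B₂]
    rw [← ENNReal.ofReal_mul (by positivity), ← ENNReal.ofReal_mul (by positivity)]
    refine ENNReal.ofReal_le_ofReal ?_
    -- Bounding `1 + a + b` by `(1 + a) * (1 + b)` separates the two copies, so the dominating
    -- function is a product, integrable for `Γ ⊗ Γ`.
    have hA := hbound θ z.1.1 z.2.1 (w z.1 * w z.2) (by
      simp only [w]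
      nlinarith [norm_nonneg z.1.1, norm_nonneg z.1.2, norm_nonneg z.2.1, norm_nonneg z.2.2,
        mul_nonneg (norm_nonneg z.1.1) (norm_nonneg z.2.1),
        mul_nonneg (norm_nonneg z.1.1) (norm_nonneg z.2.2),
        mul_nonneg (norm_nonneg z.1.2) (norm_nonneg z.2.1),
        mul_nonneg (norm_nonneg z.1.2) (norm_nonneg z.2.2)])
    have hB := hbound θ z.1.2 z.2.2 (w z.1 * w z.2) (by
      simp only [w]
      nlinarith [norm_nonneg z.1.1, norm_nonneg z.1.2, norm_nonneg z.2.1, norm_nonneg z.2.2,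
        mul_nonneg (norm_nonneg z.1.1) (norm_nonneg z.2.1),
        mul_nonneg (norm_nonneg z.1.1) (norm_nonneg z.2.2),
        mul_nonneg (norm_nonneg z.1.2) (norm_nonneg z.2.1),
        mul_nonneg (norm_nonneg z.1.2) (norm_nonneg z.2.2)])
    have hA0 := hd₁.nonneg ⟪(θ : Euc d), z.1.1⟫ ⟪(θ : Euc d), z.2.1⟫
    have hB0 := hd₁.nonneg ⟪(θ : Euc d), z.1.2⟫ ⟪(θ : Euc d), z.2.2⟫
    have e : |K| ^ 2 * (w z.1 ^ (2 * p) * w z.2 ^ (2 * p)) = (|K| * (w z.1 * w z.2) ^ p) ^ 2 := by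
      rw [pow_mul' (w z.1), pow_mul' (w z.2), mul_pow, mul_pow, mul_pow]
    rw [e]
    -- Both distances lie in `[0, B]`, so their difference lies in `[-B, B]`.
    refine sq_le_sq' ?_ ?_ <;> linarith
  have hform := fun θ : Sph d => fgwCost_projPair hc.measurable β θ (Γ : Measure (Euc d × Euc d))
  constructor
  · simp only [hform]
    refine Continuous.add ?_ ?_
    · refine (ENNReal.continuous_const_mul ENNReal.ofReal_ne_top).comp ?_
      refine continuous_iff_continuousAt.2 fun θ => ?_
      refine tendsto_lintegral_filter_of_dominated_convergence B₁ (Eventually.of_forall fun θ' => ?_)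
        (Eventually.of_forall fun θ' => Eventually.of_forall fun z => hle₁ θ' z) hB₁
        (Eventually.of_forall fun z => ?_)
      · exact (hcomp _ _ (by fun_prop) (by fun_prop)).measurable.ennreal_ofReal
      · exact (ENNReal.continuous_ofReal.comp
          (hcomp (fun θ : Sph d => ⟪(θ : Euc d), z.1⟫) (fun θ : Sph d => ⟪(θ : Euc d), z.2⟫)
            (by fun_prop) (by fun_prop))).tendsto θ
    · refine (ENNReal.continuous_const_mul ENNReal.ofReal_ne_top).comp ?_
      refine continuous_iff_continuousAt.2 fun θ => ?_
      refine tendsto_lintegral_filter_of_dominated_convergence B₂ (Eventually.of_forall fun θ' => ?_)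
        (Eventually.of_forall fun θ' => Eventually.of_forall fun z => hle₂ θ' z) hB₂
        (Eventually.of_forall fun z => ?_)
      · exact (((hcomp _ _ (by fun_prop) (by fun_prop)).sub
          (hcomp _ _ (by fun_prop) (by fun_prop))).pow 2).measurable.ennreal_ofReal
      · exact (ENNReal.continuous_ofReal.comp
          (((hcomp (fun θ : Sph d => ⟪(θ : Euc d), z.1.1⟫) (fun θ : Sph d => ⟪(θ : Euc d), z.2.1⟫)
            (by fun_prop) (by fun_prop)).sub
            (hcomp (fun θ : Sph d => ⟪(θ : Euc d), z.1.2⟫) (fun θ : Sph d => ⟪(θ : Euc d), z.2.2⟫)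
            (by fun_prop) (by fun_prop))).pow 2)).tendsto θ
  · intro θ
    rw [hform]
    exact ENNReal.add_lt_top.2
      ⟨ENNReal.mul_lt_top ENNReal.ofReal_lt_top
        ((lintegral_mono (hle₁ θ)).trans_lt hB₁.lt_top),
      ENNReal.mul_lt_top ENNReal.ofReal_lt_top
        ((lintegral_mono (hle₂ θ)).trans_lt hB₂.lt_top)⟩

/-- An infimum of functions continuous in `θ` is upper semicontinuous, so it attains its supremum on
the compact sphere; any single coupling shows that the value is finite. -/
theorem exists_max_Dfgw_proj {d : ℕ} (hd : 1 ≤ d) {d₁ : ℝ → ℝ → ℝ} (hd₁ : IsPseudoMetric d₁)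
    (hc : Continuous (Function.uncurry d₁)) (hgrowth : PolynomialGrowth d₁) (β : ℝ)
    (μ ν : Measure (Euc d)) [IsProbabilityMeasure μ] [IsProbabilityMeasure ν]
    (hμ : FiniteMoments μ) (hν : FiniteMoments ν) :
    maxSFG d₁ β μ ν < ∞ ∧
      ∃ θ : Sph d, Dfgw d₁ β (proj θ μ) (proj θ ν) = maxSFG d₁ β μ ν := by
  have : Nonempty (Sph d) := nonempty_sph hd
  have husc : UpperSemicontinuous fun θ : Sph d => Dfgw d₁ β (proj θ μ) (proj θ ν) := by
    simp only [Dfgw_proj_eq_biInf]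
    exact upperSemicontinuous_biInf fun Γ hΓ =>
      (continuous_and_fgwCost_lt_top hd₁ hc hgrowth β hμ hν hΓ).1.upperSemicontinuous
  obtain ⟨θ, -, hθ⟩ := (husc.upperSemicontinuousOn _).exists_isMaxOn Set.univ_nonempty
    isCompact_univ
  have hmax : Dfgw d₁ β (proj θ μ) (proj θ ν) = maxSFG d₁ β μ ν :=
    le_antisymm (le_iSup (fun θ : Sph d => Dfgw d₁ β (proj θ μ) (proj θ ν)) θ)
      (iSup_le fun θ' => hθ (Set.mem_univ θ'))
  refine ⟨?_, θ, hmax⟩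
  obtain ⟨Γ, hΓ⟩ := couplings_nonempty μ ν
  rw [← hmax, Dfgw_proj_eq_biInf]
  exact (iInf₂_le Γ hΓ).trans_lt ((continuous_and_fgwCost_lt_top hd₁ hc hgrowth β hμ hν hΓ).2 θ)

/-! ### Comparison of vMF means, part (b) and the limit at zero -/

/-- No measurability of `f` is needed, because the density is measurable and finite; the lower
integrals of the statement are therefore covered. -/
theorem lintegral_vMF {d : ℕ} (ε : Sph d) (κ : ℝ) (f : Sph d → ℝ≥0∞) :
    ∫⁻ θ, f θ ∂(vMF ε κ) = ∫⁻ θ, ENNReal.ofReal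
      (vMFConst d κ * Real.exp (κ * ⟪(ε : Euc d), (θ : Euc d)⟫)) * f θ ∂(surface d) := by
  rw [vMF, lintegral_withDensity_eq_lintegral_mul_non_measurable]
  · rfl
  · fun_prop
  · exact Eventually.of_forall fun _ => ENNReal.ofReal_lt_top

/-- Harnack type comparison of von Mises-Fisher means with different modes. -/
theorem lintegral_vMF_le_mul {d : ℕ} (hd : 1 ≤ d) {κ : ℝ} (hκ : 0 < κ) (f : Sph d → ℝ≥0∞)
    (ε ε' : Sph d) :
    ∫⁻ θ, f θ ∂(vMF ε' κ) ≤ ENNReal.ofReal (Real.exp (κ * dist ε ε')) * ∫⁻ θ, f θ ∂(vMF ε κ) := by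
  have hC := (vMFConst_pos hd ε hκ).le
  rw [lintegral_vMF, lintegral_vMF, ← lintegral_const_mul' _ _ ENNReal.ofReal_ne_top]
  refine lintegral_mono fun θ => ?_
  simp only
  rw [← mul_assoc, ← ENNReal.ofReal_mul (Real.exp_pos _).le]
  refine mul_le_mul' (ENNReal.ofReal_le_ofReal ?_) le_rfl
  rw [mul_left_comm, ← Real.exp_add, ← mul_add]
  refine mul_le_mul_of_nonneg_left (Real.exp_le_exp.2 (mul_le_mul_of_nonneg_left ?_ hκ.le)) hC
  have h : ⟪(ε' : Euc d) - ε, (θ : Euc d)⟫ ≤ dist ε ε' := by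
    refine (real_inner_le_norm _ _).trans ?_
    rw [norm_sph θ, mul_one, Subtype.dist_eq, dist_comm, dist_eq_norm]
  rw [inner_sub_left] at h
  linarith

/-- A function satisfying an exponential Harnack inequality on a compact space attains its
supremum. -/
theorem exists_eq_iSup_of_le_exp_dist_mul {X : Type*} [PseudoMetricSpace X] [CompactSpace X]
    [Nonempty X] {g : X → ℝ≥0∞} {κ : ℝ}
    (hg : ∀ x y, g y ≤ ENNReal.ofReal (Real.exp (κ * dist x y)) * g x) :
    ∃ x, g x = ⨆ y, g y := by
  have husc : UpperSemicontinuous g := by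
    intro x c hc
    -- Upper semicontinuity only concerns `c > g x`, so `g x` is finite here and multiplication by
    -- it is continuous.
    have hx : g x ≠ ∞ := (lt_of_lt_of_le hc le_top).ne
    have hcont : Continuous fun y => ENNReal.ofReal (Real.exp (κ * dist x y)) * g x :=
      (ENNReal.continuous_mul_const hx).comp
        (ENNReal.continuous_ofReal.comp (by fun_prop))
    have h0 : ENNReal.ofReal (Real.exp (κ * dist x x)) * g x < c := by simpa using hc
    filter_upwards [hcont.continuousAt.eventually_lt_const h0] with y hy
    exact (hg x y).trans_lt hy
  obtain ⟨x, -, hx⟩ := (husc.upperSemicontinuousOn _).exists_isMaxOn Set.univ_nonempty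
    isCompact_univ
  exact ⟨x, le_antisymm (le_iSup g x) (iSup_le fun y => hx (Set.mem_univ y))⟩

theorem surface_univ_mul_SFG {d : ℕ} (hd : 1 ≤ d) (d₁ : ℝ → ℝ → ℝ) (β : ℝ)
    (μ ν : Measure (Euc d)) :
    surface d Set.univ * SFG d₁ β μ ν =
      ∫⁻ θ, Dfgw d₁ β (proj θ μ) (proj θ ν) ∂(surface d) := by
  have ⟨ε⟩ := nonempty_sph hd
  have h0 : surface d Set.univ ≠ 0 := fun h =>
    surface_ne_zero ε (Measure.measure_univ_eq_zero.1 h)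
  rw [SFG, uniformSphere, lintegral_smul_measure, smul_eq_mul, ← mul_assoc,
    ENNReal.mul_inv_cancel h0 (measure_ne_top _ _), one_mul]

theorem le_SSFG {d : ℕ} (hd : 1 ≤ d) (d₁ : ℝ → ℝ → ℝ) (β : ℝ) (μ ν : Measure (Euc d))
    {κ : ℝ} (hκ : 0 < κ) :
    ENNReal.ofReal (Real.exp (-κ) * vMFConst d κ) * surface d Set.univ * SFG d₁ β μ ν ≤
      SSFG d₁ β κ μ ν := by
  have ⟨ε⟩ := nonempty_sph hd
  refine le_trans ?_ (le_iSup (vMFMean d₁ β κ μ ν) ε)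
  rw [mul_assoc, surface_univ_mul_SFG hd, vMFMean, lintegral_vMF,
    ← lintegral_const_mul' _ _ ENNReal.ofReal_ne_top]
  refine lintegral_mono fun θ => mul_le_mul' (ENNReal.ofReal_le_ofReal ?_) le_rfl
  rw [mul_comm]
  refine mul_le_mul_of_nonneg_left (Real.exp_le_exp.2 ?_) (vMFConst_pos hd ε hκ).le
  nlinarith [abs_le.1 (abs_inner_le_one ε θ)]

theorem SSFG_le {d : ℕ} (hd : 1 ≤ d) (d₁ : ℝ → ℝ → ℝ) (β : ℝ) (μ ν : Measure (Euc d))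
    {κ : ℝ} (hκ : 0 < κ) :
    SSFG d₁ β κ μ ν ≤
      ENNReal.ofReal (Real.exp κ * vMFConst d κ) * surface d Set.univ * SFG d₁ β μ ν := by
  refine iSup_le fun ε => ?_
  rw [mul_assoc, surface_univ_mul_SFG hd, vMFMean, lintegral_vMF,
    ← lintegral_const_mul' _ _ ENNReal.ofReal_ne_top]
  refine lintegral_mono fun θ => mul_le_mul' (ENNReal.ofReal_le_ofReal ?_) le_rfl
  rw [mul_comm (Real.exp κ)]
  refine mul_le_mul_of_nonneg_left (Real.exp_le_exp.2 ?_) (vMFConst_pos hd ε hκ).le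
  nlinarith [abs_le.1 (abs_inner_le_one ε θ)]

theorem SSFG_le_maxSFG {d : ℕ} (hd : 1 ≤ d) (d₁ : ℝ → ℝ → ℝ) (β : ℝ) (μ ν : Measure (Euc d))
    {κ : ℝ} (hκ : 0 < κ) : SSFG d₁ β κ μ ν ≤ maxSFG d₁ β μ ν := by
  refine iSup_le fun ε => ?_
  calc vMFMean d₁ β κ μ ν ε ≤ ∫⁻ _, maxSFG d₁ β μ ν ∂(vMF ε κ) :=
        lintegral_mono fun θ => le_iSup (fun θ : Sph d => Dfgw d₁ β (proj θ μ) (proj θ ν)) θ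
    _ = maxSFG d₁ β μ ν := by rw [lintegral_const, vMF_univ hd ε hκ, mul_one]

/-- The total mass is 1, while the exponential lies between `e^{-κ}` and `e^κ` on the sphere. -/
theorem exp_neg_le_vMFConst_mul_surface {d : ℕ} (hd : 1 ≤ d) {κ : ℝ} (hκ : 0 < κ) :
    Real.exp (-κ) ≤ vMFConst d κ * (surface d).real Set.univ ∧
      vMFConst d κ * (surface d).real Set.univ ≤ Real.exp κ := by
  have ⟨ε⟩ := nonempty_sph hd
  have h := vMFConst_mul_integral hd ε hκ
  have hC := vMFConst_pos hd ε hκ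
  have hup : ∫ s, Real.exp (κ * ⟪(ε : Euc d), (s : Euc d)⟫) ∂(surface d) ≤
      (surface d).real Set.univ * Real.exp κ := by
    rw [← smul_eq_mul, ← integral_const]
    refine integral_mono (integrable_exp_inner ε κ) (integrable_const _) fun θ =>
      Real.exp_le_exp.2 ?_
    nlinarith [abs_le.1 (abs_inner_le_one ε θ)]
  have hlow : (surface d).real Set.univ * Real.exp (-κ) ≤
      ∫ s, Real.exp (κ * ⟪(ε : Euc d), (s : Euc d)⟫) ∂(surface d) := by
    rw [← smul_eq_mul, ← integral_const]
    refine integral_mono (integrable_const _) (integrable_exp_inner ε κ) fun θ =>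
      Real.exp_le_exp.2 ?_
    nlinarith [abs_le.1 (abs_inner_le_one ε θ)]
  constructor
  · rw [Real.exp_neg, inv_le_iff_one_le_mul₀ (Real.exp_pos _), mul_assoc]
    exact h.symm.le.trans (mul_le_mul_of_nonneg_left hup hC.le)
  · rw [Real.exp_neg, ← div_eq_mul_inv, div_le_iff₀ (Real.exp_pos _)] at hlow
    calc _ ≤ vMFConst d κ * ((∫ s, Real.exp (κ * ⟪(ε : Euc d), (s : Euc d)⟫) ∂(surface d)) *
          Real.exp κ) := mul_le_mul_of_nonneg_left hlow hC.le
      _ = _ := by rw [← mul_assoc, h, one_mul]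

theorem tendsto_SSFG_zero {d : ℕ} (hd : 1 ≤ d) (d₁ : ℝ → ℝ → ℝ) (β : ℝ) (μ ν : Measure (Euc d)) :
    Tendsto (fun κ : ℝ => SSFG d₁ β κ μ ν) (𝓝[>] 0) (𝓝 (SFG d₁ β μ ν)) := by
  have hlim : ∀ a : ℝ, Tendsto (fun κ : ℝ => ENNReal.ofReal (Real.exp (a * κ)) * SFG d₁ β μ ν)
      (𝓝[>] 0) (𝓝 (SFG d₁ β μ ν)) := by
    intro a
    have h : Continuous fun κ : ℝ => ENNReal.ofReal (Real.exp (a * κ)) :=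
      ENNReal.continuous_ofReal.comp (by fun_prop)
    have h0 := (h.tendsto 0).mono_left (nhdsWithin_le_nhds (s := Set.Ioi 0))
    simp only [mul_zero, Real.exp_zero, ENNReal.ofReal_one] at h0
    simpa using ENNReal.Tendsto.mul_const (b := SFG d₁ β μ ν) h0 (Or.inl one_ne_zero)
  have hS : surface d Set.univ = ENNReal.ofReal ((surface d).real Set.univ) :=
    (ofReal_measureReal (measure_ne_top _ _)).symm
  -- The exponent 2 combines one factor `e^{±κ}` from the density with one from `C_d(κ) |S|`.
  refine tendsto_of_tendsto_of_tendsto_of_le_of_le' (hlim (-2)) (hlim 2) ?_ ?_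
  · filter_upwards [self_mem_nhdsWithin] with κ hκ
    refine le_trans ?_ (le_SSFG hd d₁ β μ ν hκ)
    rw [hS, ← ENNReal.ofReal_mul' measureReal_nonneg]
    refine mul_le_mul' (ENNReal.ofReal_le_ofReal ?_) le_rfl
    rw [show -2 * κ = -κ + -κ by ring, Real.exp_add, mul_assoc]
    exact mul_le_mul_of_nonneg_left (exp_neg_le_vMFConst_mul_surface hd hκ).1 (Real.exp_pos _).le
  · filter_upwards [self_mem_nhdsWithin] with κ hκ
    refine (SSFG_le hd d₁ β μ ν hκ).trans ?_
    rw [hS, ← ENNReal.ofReal_mul' measureReal_nonneg]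
    refine mul_le_mul' (ENNReal.ofReal_le_ofReal ?_) le_rfl
    rw [two_mul, Real.exp_add, mul_assoc]
    exact mul_le_mul_of_nonneg_left (exp_neg_le_vMFConst_mul_surface hd hκ).2 (Real.exp_pos _).le

/-! ### Concentration and the limit at infinity -/

/-- The von Mises-Fisher distributions concentrate at their mode as `κ → ∞`. -/
theorem tendsto_vMF_ball {d : ℕ} (hd : 1 ≤ d) (ε : Sph d) {r : ℝ} (hr : 0 < r) :
    Tendsto (fun κ : ℝ => vMF ε κ (Metric.ball ε r)) atTop (𝓝 1) := by
  -- For unit vectors `‖ε - s‖² = 2 - 2⟪ε, s⟫`, so distance at least `r` means inner product at most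
  -- `1 - r² / 2`.
  set δ := r ^ 2 / 2 with hδ
  have hδ0 : 0 < δ := by positivity
  have hball : ∀ s : Sph d, s ∉ Metric.ball ε r → ⟪(ε : Euc d), (s : Euc d)⟫ ≤ 1 - δ := by
    intro s hs
    have h1 : r ≤ ‖(ε : Euc d) - s‖ := by
      rw [← dist_eq_norm, dist_comm, ← Subtype.dist_eq]
      simpa using hs
    have h2 := norm_sub_sq_real (ε : Euc d) (s : Euc d)
    rw [norm_sph, norm_sph] at h2
    have h3 := pow_le_pow_left₀ hr.le h1 2
    linarith
  -- On this cap the exponent exceeds its values off the ball by at least `κ δ / 2`. The cap has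
  -- positive area and vMF mass at most 1, which bounds `C_d(κ)` without Bessel asymptotics.
  set V : Set (Sph d) := {s | 1 - δ / 2 < ⟪(ε : Euc d), (s : Euc d)⟫} with hV
  have hVo : IsOpen V := isOpen_lt continuous_const (by fun_prop)
  have hVε : ε ∈ V := by
    change 1 - δ / 2 < ⟪(ε : Euc d), (ε : Euc d)⟫
    rw [real_inner_self_eq_norm_sq, norm_sph]
    linarith
  have hV0 : surface d V ≠ 0 := by
    rw [surface]; exact hVo.measure_ne_zero _ ⟨ε, hVε⟩
  have hcompl : ∀ κ : ℝ, 0 < κ → vMF ε κ (Metric.ball ε r)ᶜ ≤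
      ENNReal.ofReal (Real.exp (-(δ / 2) * κ)) * (surface d Set.univ / surface d V) := by
    intro κ hκ
    have hC := (vMFConst_pos hd ε hκ).le
    have h1 : vMF ε κ (Metric.ball ε r)ᶜ ≤
        ENNReal.ofReal (vMFConst d κ * Real.exp (κ * (1 - δ))) * surface d Set.univ := by
      rw [vMF, withDensity_apply _ Metric.isOpen_ball.measurableSet.compl]
      calc _ ≤ ∫⁻ _ in (Metric.ball ε r)ᶜ,
            ENNReal.ofReal (vMFConst d κ * Real.exp (κ * (1 - δ))) ∂(surface d) := by
            refine setLIntegral_mono (by fun_prop) fun s hs => ENNReal.ofReal_le_ofReal ?_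
            exact mul_le_mul_of_nonneg_left (Real.exp_le_exp.2
              (mul_le_mul_of_nonneg_left (hball s hs) hκ.le)) hC
        _ ≤ _ := by
            rw [setLIntegral_const]
            exact mul_le_mul' le_rfl (measure_mono (Set.subset_univ _))
    have h2 : ENNReal.ofReal (vMFConst d κ * Real.exp (κ * (1 - δ / 2))) * surface d V ≤ 1 := by
      rw [← vMF_univ hd ε hκ]
      refine le_trans ?_ (measure_mono (Set.subset_univ V))
      rw [vMF, withDensity_apply _ hVo.measurableSet, ← setLIntegral_const]
      refine setLIntegral_mono (by fun_prop) fun s hs => ENNReal.ofReal_le_ofReal ?_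
      exact mul_le_mul_of_nonneg_left (Real.exp_le_exp.2
        (mul_le_mul_of_nonneg_left (le_of_lt hs) hκ.le)) hC
    have h3 : ENNReal.ofReal (vMFConst d κ * Real.exp (κ * (1 - δ / 2))) ≤ (surface d V)⁻¹ := by
      rwa [ENNReal.le_inv_iff_mul_le]
    refine h1.trans ?_
    have e : vMFConst d κ * Real.exp (κ * (1 - δ)) =
        Real.exp (-(δ / 2) * κ) * (vMFConst d κ * Real.exp (κ * (1 - δ / 2))) := by
      rw [mul_left_comm, ← Real.exp_add]
      congr 2; ring
    rw [e, ENNReal.ofReal_mul (Real.exp_pos _).le, mul_assoc, ENNReal.div_eq_inv_mul]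
    exact mul_le_mul' le_rfl (mul_le_mul' h3 le_rfl)
  have hzero : Tendsto (fun κ : ℝ => vMF ε κ (Metric.ball ε r)ᶜ) atTop (𝓝 0) := by
    refine tendsto_of_tendsto_of_tendsto_of_le_of_le' tendsto_const_nhds
      (h := fun κ => ENNReal.ofReal (Real.exp (-(δ / 2) * κ)) *
        (surface d Set.univ / surface d V)) ?_ (Eventually.of_forall fun _ => zero_le) ?_
    · have h : Tendsto (fun κ : ℝ => ENNReal.ofReal (Real.exp (-(δ / 2) * κ))) atTop (𝓝 0) := by
        rw [← ENNReal.ofReal_zero]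
        refine (ENNReal.continuous_ofReal.tendsto 0).comp (Real.tendsto_exp_atBot.comp ?_)
        exact tendsto_id.const_mul_atTop_of_neg (by linarith)
      simpa using ENNReal.Tendsto.mul_const h
        (Or.inr (ENNReal.div_lt_top (measure_ne_top (surface d) _) hV0).ne)
    · filter_upwards [eventually_gt_atTop 0] with κ hκ using hcompl κ hκ
  have hsub := ENNReal.Tendsto.sub (tendsto_const_nhds (x := (1 : ℝ≥0∞))) hzero
    (Or.inl ENNReal.one_ne_top)
  rw [tsub_zero] at hsub
  refine hsub.congr' ?_
  filter_upwards [eventually_gt_atTop 0] with κ hκ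
  have : IsProbabilityMeasure (vMF ε κ) := ⟨vMF_univ hd ε hκ⟩
  rw [prob_compl_eq_one_sub Metric.isOpen_ball.measurableSet,
    ENNReal.sub_sub_cancel ENNReal.one_ne_top prob_le_one]

/-- The upper bound is `SSFG_le_maxSFG`. For the lower one, a near-optimal `θ` is taken as mode: by
lower semicontinuity the discrepancy stays large on a ball around `θ`, which carries almost all the
mass. -/
theorem tendsto_SSFG_atTop {d : ℕ} (hd : 1 ≤ d) {d₁ : ℝ → ℝ → ℝ}
    (hc : Continuous (Function.uncurry d₁)) (β : ℝ) (μ ν : Measure (Euc d))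
    [IsProbabilityMeasure μ] [IsProbabilityMeasure ν] :
    Tendsto (fun κ : ℝ => SSFG d₁ β κ μ ν) atTop (𝓝 (maxSFG d₁ β μ ν)) := by
  refine tendsto_order.2 ⟨fun c hcm => ?_, fun c hcm => ?_⟩
  · obtain ⟨θ, hθ⟩ := lt_iSup_iff.1 hcm
    obtain ⟨c', hcc', hc'⟩ := exists_between hθ
    obtain ⟨r, hr, hball⟩ := Metric.eventually_nhds_iff_ball.1
      (lowerSemicontinuous_Dfgw_proj hc β μ ν θ c' hc')
    have hlim := ENNReal.Tendsto.const_mul (a := c') (tendsto_vMF_ball hd θ hr)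
      (Or.inl one_ne_zero)
    rw [mul_one] at hlim
    filter_upwards [hlim.eventually_const_lt hcc'] with κ hκ
    refine hκ.trans_le (le_trans ?_ (le_iSup (vMFMean d₁ β κ μ ν) θ))
    rw [← setLIntegral_const]
    calc _ ≤ ∫⁻ s in Metric.ball θ r, Dfgw d₁ β (proj s μ) (proj s ν) ∂(vMF θ κ) :=
          setLIntegral_mono' Metric.isOpen_ball.measurableSet fun s hs => (hball s hs).le
      _ ≤ _ := setLIntegral_le_lintegral _ _
  · filter_upwards [eventually_gt_atTop 0] with κ hκ
    exact (SSFG_le_maxSFG hd d₁ β μ ν hκ).trans_lt hcm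

end SFGW

end

theorem theorem2 (d : ℕ) (hd : 1 ≤ d)
    (μ ν : Measure (SFGW.Euc d)) [IsProbabilityMeasure μ] [IsProbabilityMeasure ν]
    (β : ℝ) (hβ : β ∈ Set.Icc (0 : ℝ) 1)
    (d₁ : ℝ → ℝ → ℝ) (hd₁ : SFGW.IsPseudoMetric d₁)
    (hmeas : Measurable (Function.uncurry d₁)) :
    -- the maximum defining SSFG is attained
    (∀ κ : ℝ, 0 < κ → ∃ ε : SFGW.Sph d, SFGW.vMFMean d₁ β κ μ ν ε = SFGW.SSFG d₁ β κ μ ν) ∧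
    -- the minimum defining the fused Gromov Wasserstein discrepancy is attained
    (Continuous (Function.uncurry d₁) → ∀ θ : SFGW.Sph d, ∃ π : Measure (ℝ × ℝ),
      SFGW.IsTransportPlan (SFGW.proj θ μ) (SFGW.proj θ ν) π ∧
        SFGW.fgwCost d₁ β π = SFGW.Dfgw d₁ β (SFGW.proj θ μ) (SFGW.proj θ ν)) ∧
    -- the maximum defining max-SFG is finite and attained
    (Continuous (Function.uncurry d₁) → SFGW.PolynomialGrowth d₁ →
      SFGW.FiniteMoments μ → SFGW.FiniteMoments ν →
        SFGW.maxSFG d₁ β μ ν < ∞ ∧ ∃ θ : SFGW.Sph d,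
          SFGW.Dfgw d₁ β (SFGW.proj θ μ) (SFGW.proj θ ν) = SFGW.maxSFG d₁ β μ ν) ∧
    -- part (a)
    Tendsto (fun κ : ℝ => SFGW.SSFG d₁ β κ μ ν) (𝓝[>] 0) (𝓝 (SFGW.SFG d₁ β μ ν)) ∧
    (Continuous (Function.uncurry d₁) →
      Tendsto (fun κ : ℝ => SFGW.SSFG d₁ β κ μ ν) atTop (𝓝 (SFGW.maxSFG d₁ β μ ν))) ∧
    -- part (b)
    (∀ κ : ℝ, 0 < κ →
      ENNReal.ofReal (Real.exp (-κ) * SFGW.vMFConst d κ) * SFGW.surface d Set.univ *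
          SFGW.SFG d₁ β μ ν ≤ SFGW.SSFG d₁ β κ μ ν ∧
      SFGW.SSFG d₁ β κ μ ν ≤
        ENNReal.ofReal (Real.exp κ * SFGW.vMFConst d κ) * SFGW.surface d Set.univ *
          SFGW.SFG d₁ β μ ν ∧
      SFGW.SSFG d₁ β κ μ ν ≤ SFGW.maxSFG d₁ β μ ν) := by
  refine ⟨fun κ hκ => ?_, fun hc θ => SFGW.exists_optimal_plan hc β μ ν θ,
    fun hc hg hμ hν => SFGW.exists_max_Dfgw_proj hd hd₁ hc hg β μ ν hμ hν,
    SFGW.tendsto_SSFG_zero hd d₁ β μ ν, fun hc => SFGW.tendsto_SSFG_atTop hd hc β μ ν,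
    fun κ hκ => ⟨SFGW.le_SSFG hd d₁ β μ ν hκ, SFGW.SSFG_le hd d₁ β μ ν hκ,
      SFGW.SSFG_le_maxSFG hd d₁ β μ ν hκ⟩⟩
  have := SFGW.nonempty_sph hd
  exact SFGW.exists_eq_iSup_of_le_exp_dist_mul (g := SFGW.vMFMean d₁ β κ μ ν)
    fun ε ε' => SFGW.lintegral_vMF_le_mul hd hκ _ ε ε'
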